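/- Let $(R,\mathfrak m,k)$ be a commutative Noetherian Cohen-Macaulay local ring of Krull dimension $d$ with canonical module $\omega_R$, i.e. a maximal Cohen-Macaulay $R$-module of finite injective dimension with $\dim_k \mathrm{Ext}^d_R(k,\omega_R)=1$. Here a finitely generated $R$-module $M$ is called maximal Cohen-Macaulay if $M=0$ or $\mathrm{depth}_R M=\dim_R M=d$. Let $\Lambda$ be a semiperfect $R$-order, i.e. a semiperfect $R$-algebra that is maximal Cohen-Macaulay as an $R$-module. Modules over $\Lambda$ are right modules; $\mathrm{CM}(\Lambda)$ denotes the exact category of $\Lambda$-modules that are maximal Cohen-Macaulay over $R$, and a module is called CM-injective if it is an injective object of $\mathrm{CM}(\Lambda)$. Put $\omega=\mathrm{Hom}_R(\Lambda,\omega_R)$ and let $\Pi$ be a $\Lambda$-module with $\mathrm{add}\,\Pi=\mathrm{add}\,\Lambda\cap\mathrm{add}\,\omega$. A CM-injective coresolution of $\Lambda$ is an exact sequence of $\Lambda$-modules $0\to\Lambda\to I^0\to I^1\to\cdots$ with all $I^j$ CM-injective; it is minimal if all its maps are left minimal. The CM-dominant dimension of $\Lambda$ is the smallest $\ell$ such that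 $I^\ell$ is not projective in a minimal CM-injective coresolution ($\infty$ if there is none), and $\Lambda$ is called a QF-3 order if its CM-dominant dimension is at least $1$. Suppose that $\Lambda$ is a QF-3 order, and let $i\colon\Lambda\to\Pi^0$ with $\Pi^0\in\mathrm{add}\,\Pi$ be the first map of a (not necessarily minimal) CM-injective coresolution $0\to\Lambda\xrightarrow{i}\Pi^0\to I^1\to I^2\to\cdots$ of $\Lambda$. Let $K$ be the cokernel of $i$ and put $T=K\oplus\Pi$. Then $K$ is maximal Cohen-Macaulay, and the endomorphism ring $\Gamma=\mathrm{End}_\Lambda(T)$ is maximal Cohen-Macaulay as an $R$-module, that is, $\Gamma$ is an $R$-order. -/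

import Mathlib

universe u

open MulOpposite

/-! Right modules over a ring `Λ` are written as modules over `Λᵐᵒᵖ`.  A right module over an
`R`-algebra `Λ` carries its `R`-module structure through `[IsScalarTower R Λᵐᵒᵖ M]`. -/

section Commutative

variable (R : Type u) [CommRing R] [IsLocalRing R]

/-- The depth of a module over a local ring: the supremum of the lengths of the sequences
`r₁, …, r_ℓ` in the maximal ideal such that `r_j` is a nonzerodivisor on
`M / (r₁, …, r_{j-1}) M` for every `j`. -/
noncomputable def moduleDepth (M : Type u) [AddCommGroup M] [Module R M] : ℕ∞ :=
  sSup {l : ℕ∞ | ∃ rs : List R, (∀ r ∈ rs, r ∈ IsLocalRing.maximalIdeal R) ∧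
    RingTheory.Sequence.IsWeaklyRegular M rs ∧ l = (rs.length : ℕ∞)}

/-- The dimension of a module: the Krull dimension of `R / ann M`. -/
noncomputable def moduleDim (M : Type u) [AddCommGroup M] [Module R M] : WithBot ℕ∞ :=
  ringKrullDim (R ⧸ Module.annihilator R M)

/-- Maximal Cohen-Macaulay modules: finitely generated modules `M` that are zero or satisfy
`depth M = dim M = dim R`. -/
def IsMCM (M : Type u) [AddCommGroup M] [Module R M] : Prop :=
  Module.Finite R M ∧ (Subsingleton M ∨
    ((moduleDepth R M : WithBot ℕ∞) = moduleDim R M ∧ moduleDim R M = ringKrullDim R))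

open CategoryTheory in
/-- Canonical modules of a local ring `R` with residue field `k`: maximal Cohen-Macaulay modules
of finite injective dimension such that `Ext^d(k, ω)` is one-dimensional over `k`, where
`d = dim R`. -/
def IsCanonicalModule (ωR : Type u) [AddCommGroup ωR] [Module R ωR] : Prop :=
  IsMCM R ωR ∧
  (∃ n : ℕ, HasInjectiveDimensionLE (ModuleCat.of R ωR) n) ∧
  ∃ d : ℕ, ringKrullDim R = (d : WithBot ℕ∞) ∧
    Nonempty (Abelian.Ext (ModuleCat.of R (IsLocalRing.ResidueField R)) (ModuleCat.of R ωR) d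
      ≃ₗ[R] IsLocalRing.ResidueField R)

/-- An `R`-algebra is an `R`-order if it is maximal Cohen-Macaulay as an `R`-module. -/
def IsOrder (A : Type u) [Ring A] [Algebra R A] : Prop := IsMCM R A

end Commutative

/-- A ring is semiperfect if it is semisimple modulo its Jacobson radical `J` and idempotents
lift modulo `J`. -/
def IsSemiperfect (A : Type u) [Ring A] : Prop :=
  IsSemisimpleRing (A ⧸ Ring.jacobson A) ∧
  ∀ e : A, e * e - e ∈ Ring.jacobson A → ∃ f : A, f * f = f ∧ f - e ∈ Ring.jacobson A

/-- `X` belongs to `add N`: it is a direct summand of a finite direct sum of copies of `N`. -/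
def InAdd (A : Type u) [Ring A] (X N : Type u) [AddCommGroup X] [Module A X]
    [AddCommGroup N] [Module A N] : Prop :=
  ∃ (n : ℕ) (s : X →ₗ[A] (Fin n → N)) (p : (Fin n → N) →ₗ[A] X), p ∘ₗ s = LinearMap.id

/-- A homomorphism `f : X → Y` is left minimal if every endomorphism `φ` of `Y` with `φ f = f`
is an automorphism. -/
def IsLeftMinimal {A : Type u} [Ring A] {X Y : Type u} [AddCommGroup X] [Module A X]
    [AddCommGroup Y] [Module A Y] (f : X →ₗ[A] Y) : Prop :=
  ∀ φ : Y →ₗ[A] Y, φ ∘ₗ f = f → Function.Bijective φ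

section Order

variable (R : Type u) [CommRing R] (Λ : Type u) [Ring Λ] [Algebra R Λ]

/-- The module underlying `ω = Hom_R(Λ, ω_R)`. -/
def OrderOmega (ωR : Type u) [AddCommGroup ωR] [Module R ωR] : Type u := Λ →ₗ[R] ωR

noncomputable instance (ωR : Type u) [AddCommGroup ωR] [Module R ωR] :
    AddCommGroup (OrderOmega R Λ ωR) :=
  inferInstanceAs (AddCommGroup (Λ →ₗ[R] ωR))

/-- The right `Λ`-module structure `(f a)(x) = f (a x)` on `ω = Hom_R(Λ, ω_R)`. -/
noncomputable instance (ωR : Type u) [AddCommGroup ωR] [Module R ωR] :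
    Module Λᵐᵒᵖ (OrderOmega R Λ ωR) where
  smul a f := LinearMap.comp (show Λ →ₗ[R] ωR from f) (LinearMap.mulLeft R (unop a))
  one_smul f := LinearMap.ext fun x => congrArg (show Λ →ₗ[R] ωR from f) (one_mul x)
  mul_smul a b f := LinearMap.ext fun x =>
    congrArg (show Λ →ₗ[R] ωR from f) (mul_assoc (unop b) (unop a) x)
  smul_zero _ := LinearMap.ext fun _ => rfl
  smul_add _ _ _ := LinearMap.ext fun _ => rfl
  add_smul a b f := LinearMap.ext fun x =>
    (congrArg (show Λ →ₗ[R] ωR from f) (add_mul (unop a) (unop b) x)).trans (map_add _ _ _)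
  zero_smul f := LinearMap.ext fun x =>
    (congrArg (show Λ →ₗ[R] ωR from f) (zero_mul x)).trans (map_zero _)

variable [IsLocalRing R]

/-- The injective objects of the exact category `CM(Λ)` of maximal Cohen-Macaulay right
`Λ`-modules: maps into `I` extend along every monomorphism of maximal Cohen-Macaulay modules
whose cokernel is maximal Cohen-Macaulay. -/
def IsCMInjective (I : Type u) [AddCommGroup I] [Module R I] [Module Λᵐᵒᵖ I] : Prop :=
  IsMCM R I ∧
  ∀ (X Y : Type u) [AddCommGroup X] [Module R X] [Module Λᵐᵒᵖ X] [IsScalarTower R Λᵐᵒᵖ X]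
    [AddCommGroup Y] [Module R Y] [Module Λᵐᵒᵖ Y] [IsScalarTower R Λᵐᵒᵖ Y]
    (f : X →ₗ[Λᵐᵒᵖ] Y), IsMCM R X → IsMCM R Y → Function.Injective f →
    IsMCM R (Y ⧸ LinearMap.range f) →
    ∀ g : X →ₗ[Λᵐᵒᵖ] I, ∃ h : Y →ₗ[Λᵐᵒᵖ] I, h ∘ₗ f = g

/-- CM-injective coresolutions of the regular right module: exact sequences of right
`Λ`-modules `0 → Λ → I⁰ → I¹ → ⋯` whose terms `Iʲ` are CM-injective. -/
structure CMInjCoresolution where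
  I : ℕ → Type u
  [addCommGroup : ∀ j, AddCommGroup (I j)]
  [moduleR : ∀ j, Module R (I j)]
  [moduleΛ : ∀ j, Module Λᵐᵒᵖ (I j)]
  [tower : ∀ j, IsScalarTower R Λᵐᵒᵖ (I j)]
  ι : Λ →ₗ[Λᵐᵒᵖ] I 0
  d : ∀ j, I j →ₗ[Λᵐᵒᵖ] I (j + 1)
  cmInjective : ∀ j, IsCMInjective R Λ (I j)
  ι_injective : Function.Injective ι
  exact_zero : Function.Exact ι (d 0)
  exact_succ : ∀ j, Function.Exact (d j) (d (j + 1))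

attribute [instance] CMInjCoresolution.addCommGroup CMInjCoresolution.moduleR
  CMInjCoresolution.moduleΛ CMInjCoresolution.tower

namespace CMInjCoresolution

variable {R Λ}

/-- A coresolution is minimal if all its maps are left minimal (equivalently, the inclusions of
the cosyzygies into the terms are left minimal). -/
def IsMinimal (C : CMInjCoresolution R Λ) : Prop :=
  IsLeftMinimal C.ι ∧ ∀ j, IsLeftMinimal (C.d j)

/-- The cokernel `K` of `Λ → I⁰`. -/
abbrev K (C : CMInjCoresolution R Λ) : Type u := C.I 0 ⧸ LinearMap.range C.ι

end CMInjCoresolution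

/-- The CM-dominant dimension: the smallest `ℓ` such that the term `I^ℓ` of a minimal
CM-injective coresolution of `Λ` is not projective, and `⊤` if there is no such `ℓ`. -/
noncomputable def cmDomDim : ℕ∞ :=
  sInf {l : ℕ∞ | ∃ C : CMInjCoresolution R Λ, C.IsMinimal ∧
    ∃ j : ℕ, l = (j : ℕ∞) ∧ ¬ Module.Projective Λᵐᵒᵖ (C.I j)}

/-- QF-3 orders: the CM-dominant dimension is at least `1`. -/
def IsQF3 : Prop := 1 ≤ cmDomDim R Λ

/-- `Π` is an additive generator of the CM-projective-injective modules:
`add Π = add Λ ∩ add ω`. -/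
def IsCMProjInjGenerator (ωR : Type u) [AddCommGroup ωR] [Module R ωR]
    (P : Type u) [AddCommGroup P] [Module Λᵐᵒᵖ P] : Prop :=
  ∀ (X : Type u) [AddCommGroup X] [Module Λᵐᵒᵖ X],
    InAdd Λᵐᵒᵖ X P ↔ InAdd Λᵐᵒᵖ X Λ ∧ InAdd Λᵐᵒᵖ X (OrderOmega R Λ ωR)

end Order

section DepthExt

open CategoryTheory Abelian IsLocalRing RingTheory.Sequence Module

variable {R : Type u} [CommRing R]

/-- The short complex of `R`-modules given by an exact pair of linear maps. -/
abbrev shortComplexOfExact {A B C : Type u} [AddCommGroup A] [Module R A] [AddCommGroup B]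
    [Module R B] [AddCommGroup C] [Module R C] {f : A →ₗ[R] B} {g : B →ₗ[R] C}
    (h : Function.Exact f g) : ShortComplex (ModuleCat.{u} R) :=
  ModuleCat.shortComplexOfCompEqZero f g h.linearMap_comp_eq_zero

lemma shortExact_shortComplexOfExact {A B C : Type u} [AddCommGroup A] [Module R A]
    [AddCommGroup B] [Module R B] [AddCommGroup C] [Module R C] {f : A →ₗ[R] B} {g : B →ₗ[R] C}
    (h : Function.Exact f g) (hf : Function.Injective f) (hg : Function.Surjective g) :
    (shortComplexOfExact h).ShortExact :=
  ModuleCat.shortComplex_shortExact _ h hf hg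

lemma subsingleton_ext_of_retract (X : ModuleCat.{u} R) {A B : Type u} [AddCommGroup A]
    [Module R A] [AddCommGroup B] [Module R B] (s : A →ₗ[R] B) (p : B →ₗ[R] A)
    (hps : p ∘ₗ s = LinearMap.id) (n : ℕ) [Subsingleton (Ext X (ModuleCat.of R B) n)] :
    Subsingleton (Ext X (ModuleCat.of R A) n) := by
  refine subsingleton_of_forall_eq 0 fun x => ?_
  have h : ModuleCat.ofHom s ≫ ModuleCat.ofHom p = 𝟙 (ModuleCat.of R A) := by
    rw [← ModuleCat.ofHom_comp, hps]; rfl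
  rw [← Ext.comp_mk₀_id x, ← h, ← Ext.mk₀_comp_mk₀, ← Ext.comp_assoc_of_third_deg_zero,
    Subsingleton.elim (x.comp (Ext.mk₀ (ModuleCat.ofHom s)) (add_zero n)) 0, Ext.zero_comp]

lemma subsingleton_ext_of_equiv_left (Y : ModuleCat.{u} R) {A B : Type u} [AddCommGroup A]
    [Module R A] [AddCommGroup B] [Module R B] (e : A ≃ₗ[R] B) (n : ℕ)
    [Subsingleton (Ext (ModuleCat.of R B) Y n)] :
    Subsingleton (Ext (ModuleCat.of R A) Y n) := by
  refine subsingleton_of_forall_eq 0 fun x => ?_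
  have h : ModuleCat.ofHom e.toLinearMap ≫ ModuleCat.ofHom e.symm.toLinearMap =
      𝟙 (ModuleCat.of R A) := by
    ext; simp
  rw [← Ext.mk₀_id_comp x, ← h, ← Ext.mk₀_comp_mk₀_assoc,
    Subsingleton.elim ((Ext.mk₀ (ModuleCat.ofHom e.symm.toLinearMap)).comp x (zero_add n)) 0,
    Ext.comp_zero]

section Sequences

variable {A B C : Type u} [AddCommGroup A] [Module R A] [AddCommGroup B]
  [Module R B] [AddCommGroup C] [Module R C] {f : A →ₗ[R] B} {g : B →ₗ[R] C}

lemma subsingleton_ext_middle (h : Function.Exact f g) (hf : Function.Injective f)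
    (hg : Function.Surjective g) (X : ModuleCat.{u} R) (n : ℕ)
    (hA : Subsingleton (Ext X (ModuleCat.of R A) n))
    (hC : Subsingleton (Ext X (ModuleCat.of R C) n)) :
    Subsingleton (Ext X (ModuleCat.of R B) n) := by
  refine subsingleton_of_forall_eq 0 fun x => ?_
  obtain ⟨y, rfl⟩ := Ext.covariant_sequence_exact₂ X (shortExact_shortComplexOfExact h hf hg) x
    (hC.elim _ _)
  rw [hA.elim y 0, Ext.zero_comp]

lemma ext_eq_zero_of_comp_eq_zero (h : Function.Exact f g) (hf : Function.Injective f)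
    (hg : Function.Surjective g) {X : ModuleCat.{u} R} {n : ℕ}
    (a : Ext X (ModuleCat.of R A) n) (ha : a.comp (Ext.mk₀ (ModuleCat.ofHom f)) (add_zero n) = 0)
    (hC : ∀ m, m + 1 = n → Subsingleton (Ext X (ModuleCat.of R C) m)) : a = 0 := by
  cases n with
  | zero =>
    have := (shortExact_shortComplexOfExact h hf hg).mono_f
    refine Ext.postcomp_mk₀_injective_of_mono X (shortComplexOfExact h).f (ha.trans ?_)
    exact (map_zero ((Ext.mk₀ (shortComplexOfExact h).f).postcomp X (add_zero 0))).symm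
  | succ n =>
    obtain ⟨y, rfl⟩ := Ext.covariant_sequence_exact₁ X (shortExact_shortComplexOfExact h hf hg) a
      ha rfl
    rw [(hC n rfl).elim y 0, Ext.zero_comp]

lemma subsingleton_ext_cokernel (h : Function.Exact f g) (hf : Function.Injective f)
    (hg : Function.Surjective g) (X : ModuleCat.{u} R) (n : ℕ)
    (hB : Subsingleton (Ext X (ModuleCat.of R B) n))
    (hA : Subsingleton (Ext X (ModuleCat.of R A) (n + 1))) :
    Subsingleton (Ext X (ModuleCat.of R C) n) := by
  refine subsingleton_of_forall_eq 0 fun x => ?_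
  obtain ⟨y, rfl⟩ := Ext.covariant_sequence_exact₃ X (shortExact_shortComplexOfExact h hf hg) x
    rfl (hA.elim _ _)
  rw [hB.elim y 0, Ext.zero_comp]

lemma subsingleton_ext_middle_left (h : Function.Exact f g) (hf : Function.Injective f)
    (hg : Function.Surjective g) (Y : ModuleCat.{u} R) (n : ℕ)
    (hA : Subsingleton (Ext (ModuleCat.of R A) Y n))
    (hC : Subsingleton (Ext (ModuleCat.of R C) Y n)) :
    Subsingleton (Ext (ModuleCat.of R B) Y n) := by
  refine subsingleton_of_forall_eq 0 fun x => ?_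
  obtain ⟨y, rfl⟩ := Ext.contravariant_sequence_exact₂ (shortExact_shortComplexOfExact h hf hg)
    Y x (hA.elim _ _)
  rw [hC.elim y 0, Ext.comp_zero]

lemma subsingleton_ext_kernel_left (h : Function.Exact f g) (hf : Function.Injective f)
    (hg : Function.Surjective g) (Y : ModuleCat.{u} R) (n : ℕ)
    (hB : Subsingleton (Ext (ModuleCat.of R B) Y n))
    (hC : Subsingleton (Ext (ModuleCat.of R C) Y (n + 1))) :
    Subsingleton (Ext (ModuleCat.of R A) Y n) := by
  refine subsingleton_of_forall_eq 0 fun x => ?_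
  obtain ⟨y, rfl⟩ := Ext.contravariant_sequence_exact₁ (shortExact_shortComplexOfExact h hf hg)
    Y x (add_comm 1 n) (hC.elim _ _)
  rw [hB.elim y 0, Ext.comp_zero]

/-- If `Ext¹(C, Y) = 0`, then linear maps to `Y` extend along `A → B`. -/
lemma exists_extension_of_subsingleton_ext_one (h : Function.Exact f g)
    (hf : Function.Injective f) (hg : Function.Surjective g) {Y : Type u} [AddCommGroup Y]
    [Module R Y] (hC : Subsingleton (Ext (ModuleCat.of R C) (ModuleCat.of R Y) 1))
    (φ : A →ₗ[R] Y) : ∃ ψ : B →ₗ[R] Y, ψ ∘ₗ f = φ := by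
  obtain ⟨y, hy⟩ := Ext.contravariant_sequence_exact₁ (shortExact_shortComplexOfExact h hf hg)
    (ModuleCat.of R Y) (Ext.mk₀ (ModuleCat.ofHom φ)) (add_zero 1) (hC.elim _ _)
  obtain ⟨ψ, rfl⟩ := (Ext.mk₀_bijective _ _).2 y
  rw [Ext.mk₀_comp_mk₀, (Ext.mk₀_bijective _ _).1.eq_iff] at hy
  exact ⟨ψ.hom, congrArg ModuleCat.Hom.hom hy⟩

end Sequences

open Pointwise in
lemma exact_lsmul_quotSMulTop (M : Type u) [AddCommGroup M] [Module R M] (x : R) :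
    Function.Exact (LinearMap.lsmul R M x) (x • (⊤ : Submodule R M)).mkQ :=
  LinearMap.exact_lsmul_mkQ_smul_top M x

variable [IsLocalRing R]

/-- `Extⁱ(k, M) = 0` for all `i < n`, where `k` is the residue field. -/
def ExtResidueVanish (R : Type u) [CommRing R] [IsLocalRing R] (M : Type u) [AddCommGroup M]
    [Module R M] (n : ℕ) : Prop :=
  ∀ i < n, Subsingleton (Ext (ModuleCat.of R (ResidueField R)) (ModuleCat.of R M) i)

namespace ExtResidueVanish

variable {A B C : Type u} [AddCommGroup A] [Module R A] [AddCommGroup B]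
  [Module R B] [AddCommGroup C] [Module R C] {f : A →ₗ[R] B} {g : B →ₗ[R] C}

lemma mono {n m : ℕ} (h : ExtResidueVanish R A n) (hmn : m ≤ n) : ExtResidueVanish R A m :=
  fun i hi => h i (hi.trans_le hmn)

lemma of_retract {n : ℕ} (s : A →ₗ[R] B) (p : B →ₗ[R] A) (hps : p ∘ₗ s = LinearMap.id)
    (h : ExtResidueVanish R B n) : ExtResidueVanish R A n := fun i hi =>
  have := h i hi
  subsingleton_ext_of_retract _ s p hps i

lemma of_equiv {n : ℕ} (e : A ≃ₗ[R] B) (h : ExtResidueVanish R B n) : ExtResidueVanish R A n :=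
  h.of_retract e.toLinearMap e.symm.toLinearMap (by ext; simp)

lemma prod {n : ℕ} (hA : ExtResidueVanish R A n) (hC : ExtResidueVanish R C n) :
    ExtResidueVanish R (A × C) n := fun i hi =>
  subsingleton_ext_middle (f := LinearMap.inl R A C) (g := LinearMap.snd R A C)
    Function.Exact.inl_snd LinearMap.inl_injective LinearMap.snd_surjective _ i
    (hA i hi) (hC i hi)

lemma of_subsingleton [Subsingleton A] (n : ℕ) : ExtResidueVanish R A n := fun i _ => by
  refine subsingleton_of_forall_eq 0 fun x => ?_
  have : 𝟙 (ModuleCat.of R A) = 0 := by ext a; exact Subsingleton.elim (α := A) _ _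
  rw [← Ext.comp_mk₀_id x, this, Ext.mk₀_zero, Ext.comp_zero]

lemma pi {n : ℕ} (hA : ExtResidueVanish R A n) : ∀ m : ℕ, ExtResidueVanish R (Fin m → A) n
  | 0 => of_subsingleton n
  | m + 1 => (hA.prod (pi hA m)).of_equiv (Fin.consLinearEquiv R fun _ : Fin (m + 1) => A).symm

lemma kernel {n m : ℕ} (hnm : n ≤ m + 1) (h : Function.Exact f g) (hf : Function.Injective f)
    (hg : Function.Surjective g) (hB : ExtResidueVanish R B n)
    (hC : ExtResidueVanish R C m) : ExtResidueVanish R A n := fun i hi =>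
  subsingleton_of_forall_eq 0 fun a => ext_eq_zero_of_comp_eq_zero h hf hg a
    ((hB i hi).elim _ _) fun j hj => hC j (by omega)

end ExtResidueVanish

lemma smul_ext_residueField {M : Type u} [AddCommGroup M] [Module R M] {x : R}
    (hx : x ∈ maximalIdeal R) {n : ℕ}
    (a : Ext (ModuleCat.of R (ResidueField R)) (ModuleCat.of R M) n) : x • a = 0 := by
  have h : x • 𝟙 (ModuleCat.of R (ResidueField R)) = 0 := by
    ext a
    change x • (a : ResidueField R) = 0
    rw [Algebra.smul_def]
    exact (congrArg (· * a) ((residue_eq_zero_iff x).2 hx)).trans (zero_mul a)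
  rw [← Ext.mk₀_id_comp a, ← Ext.smul_comp, ← Ext.mk₀_smul, h, Ext.mk₀_zero, Ext.zero_comp]

lemma ExtResidueVanish.of_quotSMulTop {M : Type u} [AddCommGroup M] [Module R M] {x : R}
    (hx : x ∈ maximalIdeal R) (hreg : IsSMulRegular M x) {n : ℕ}
    (h : ExtResidueVanish R (QuotSMulTop x M) n) : ExtResidueVanish R M (n + 1) := by
  intro i hi
  refine subsingleton_of_forall_eq 0 fun a => ?_
  refine ext_eq_zero_of_comp_eq_zero (exact_lsmul_quotSMulTop M x) hreg
    (Submodule.mkQ_surjective _) a ?_ fun j hj => h j (by omega)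
  have h1 : ModuleCat.ofHom (LinearMap.lsmul R M x) = x • 𝟙 (ModuleCat.of R M) := rfl
  rw [h1, ← Ext.smul_eq_comp_mk₀]
  exact smul_ext_residueField hx a

lemma ExtResidueVanish.quotSMulTop {M : Type u} [AddCommGroup M] [Module R M] {x : R}
    (hreg : IsSMulRegular M x) {n : ℕ} (h : ExtResidueVanish R M (n + 1)) :
    ExtResidueVanish R (QuotSMulTop x M) n := fun i hi =>
  subsingleton_ext_cokernel (exact_lsmul_quotSMulTop M x) hreg (Submodule.mkQ_surjective _) _ i
    (h i (by omega)) (h (i + 1) (by omega))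

lemma ExtResidueVanish.of_isWeaklyRegular : ∀ (rs : List R) (M : Type u) [AddCommGroup M]
    [Module R M], (∀ r ∈ rs, r ∈ maximalIdeal R) → IsWeaklyRegular M rs →
    ExtResidueVanish R M rs.length
  | [], _, _, _, _, _ => fun i hi => absurd hi (Nat.not_lt_zero i)
  | x :: rs, M, _, _, hm, hreg => by
    rw [isWeaklyRegular_cons_iff] at hreg
    exact (of_isWeaklyRegular rs (QuotSMulTop x M) (fun r hr => hm r (List.mem_cons_of_mem _ hr))
      hreg.2).of_quotSMulTop (hm x List.mem_cons_self) hreg.1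

lemma exists_isSMulRegular_of_subsingleton_linearMap [IsNoetherianRing R] (M : Type u)
    [AddCommGroup M] [Module R M] [Module.Finite R M]
    (h : Subsingleton (ResidueField R →ₗ[R] M)) :
    ∃ x ∈ maximalIdeal R, IsSMulRegular M x := by
  have : Module.Finite R (ResidueField R) :=
    Module.Finite.of_surjective (Algebra.linearMap R (ResidueField R)) residue_surjective
  obtain ⟨x, hx, hreg⟩ := IsSMulRegular.subsingleton_linearMap_iff.1 h
  refine ⟨x, ?_, hreg⟩
  have h1 := Module.mem_annihilator.1 hx 1
  rw [Algebra.smul_def, mul_one] at h1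
  exact (residue_eq_zero_iff x).1 h1

lemma ExtResidueVanish.exists_isWeaklyRegular [IsNoetherianRing R] : ∀ (n : ℕ) (M : Type u)
    [AddCommGroup M] [Module R M] [Module.Finite R M], ExtResidueVanish R M n →
    ∃ rs : List R, (∀ r ∈ rs, r ∈ maximalIdeal R) ∧ IsWeaklyRegular M rs ∧ rs.length = n
  | 0, M, _, _, _, _ => ⟨[], by simp, IsWeaklyRegular.nil R M, rfl⟩
  | n + 1, M, _, _, _, h => by
    have h0 := h 0 n.succ_pos
    have : Subsingleton (ResidueField R →ₗ[R] M) :=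
      ((Ext.linearEquiv₀ (R := R) (X := ModuleCat.of R (ResidueField R))
        (Y := ModuleCat.of R M)).trans (ModuleCat.homLinearEquiv (S := R))).symm.toEquiv.subsingleton
    obtain ⟨x, hx, hreg⟩ := exists_isSMulRegular_of_subsingleton_linearMap M this
    obtain ⟨rs, hm, hrs, rfl⟩ := exists_isWeaklyRegular n (QuotSMulTop x M) (h.quotSMulTop hreg)
    exact ⟨x :: rs, List.forall_mem_cons.2 ⟨hx, hm⟩,
      (isWeaklyRegular_cons_iff M x rs).2 ⟨hreg, hrs⟩, rfl⟩

end DepthExt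
section CanonicalVanishing

open CategoryTheory Abelian IsLocalRing RingTheory.Sequence Module

variable {R : Type u} [CommRing R] [IsLocalRing R] [IsNoetherianRing R]

lemma length_le_supportDim_of_isWeaklyRegular {M : Type u} [AddCommGroup M] [Module R M]
    [Module.Finite R M] [Nontrivial M] {rs : List R} (hm : ∀ r ∈ rs, r ∈ maximalIdeal R)
    (hrs : IsWeaklyRegular M rs) : (rs.length : WithBot ℕ∞) ≤ supportDim R M := by
  have hreg := IsRegular.of_isWeaklyRegular_of_mem_maximalIdeal M hm hrs
  rw [← supportDim_add_length_eq_supportDim_of_isRegular rs hreg]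
  have : Nontrivial (M ⧸ Ideal.ofList rs • (⊤ : Submodule R M)) :=
    Submodule.Quotient.nontrivial_iff.2 hreg.top_ne_smul.symm
  have h0 : (0 : WithBot ℕ∞) ≤ supportDim R (M ⧸ Ideal.ofList rs • (⊤ : Submodule R M)) := by
    obtain ⟨n, hn⟩ := WithBot.ne_bot_iff_exists.1
      (supportDim_ne_bot_of_nontrivial R (M ⧸ Ideal.ofList rs • (⊤ : Submodule R M)))
    rw [← hn]
    exact WithBot.coe_le_coe.2 zero_le
  exact le_add_of_nonneg_left h0

/-- Maximal Cohen-Macaulay modules are the finitely generated modules `M` with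
`Extⁱ(k, M) = 0` for all `i < dim R`. -/
lemma isMCM_iff_extResidueVanish {d : ℕ} (hd : ringKrullDim R = (d : WithBot ℕ∞))
    (M : Type u) [AddCommGroup M] [Module R M] :
    IsMCM R M ↔ Module.Finite R M ∧ ExtResidueVanish R M d := by
  refine and_congr_right fun hfin => ⟨?_, fun h => ?_⟩
  · rintro (h | ⟨h1, h2⟩)
    · exact .of_subsingleton d
    · rw [h2, hd] at h1
      have h1 : moduleDepth R M = (d : ℕ∞) := WithBot.coe_injective h1
      cases d with
      | zero => exact fun i hi => absurd hi (Nat.not_lt_zero i)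
      | succ e =>
        have h3 : (e : ℕ∞) < moduleDepth R M := by
          rw [h1]; exact_mod_cast e.lt_succ_self
        obtain ⟨_, ⟨rs, hm, hrs, rfl⟩, hlt⟩ := lt_sSup_iff.1 h3
        exact (ExtResidueVanish.of_isWeaklyRegular rs M hm hrs).mono (by exact_mod_cast hlt)
  · rcases subsingleton_or_nontrivial M with h0 | h0
    · exact .inl h0
    right
    obtain ⟨rs, hm, hrs, hlen⟩ := h.exists_isWeaklyRegular d M
    have hle : (d : ℕ∞) ≤ moduleDepth R M := le_sSup ⟨rs, hm, hrs, by rw [hlen]⟩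
    have hdim : moduleDim R M = supportDim R M :=
      (supportDim_eq_ringKrullDim_quotient_annihilator R M).symm
    have hdimle : moduleDim R M ≤ d := by
      rw [hdim, ← hd]; exact supportDim_le_ringKrullDim R M
    have hledim : (d : WithBot ℕ∞) ≤ moduleDim R M := by
      rw [hdim, ← hlen]; exact length_le_supportDim_of_isWeaklyRegular hm hrs
    have hdepth : moduleDepth R M ≤ d := by
      refine sSup_le ?_
      rintro _ ⟨rs, hm, hrs, rfl⟩
      have := (length_le_supportDim_of_isWeaklyRegular hm hrs).trans (hdim ▸ hdimle)
      exact_mod_cast this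
    have heq := le_antisymm hdimle hledim
    rw [heq, hd, le_antisymm hdepth hle]
    exact ⟨rfl, rfl⟩

/-- If multiplication by `x ∈ 𝔪` is injective on `M` and `Extⁿ⁺¹(M / xM, Y) = 0`, then
`Extⁿ(M, Y) = 0`. -/
lemma subsingleton_ext_of_quotSMulTop {M : Type u} [AddCommGroup M] [Module R M]
    [Module.Finite R M] {Y : Type u} [AddCommGroup Y] [Module R Y] [Module.Finite R Y] {x : R}
    (hx : x ∈ maximalIdeal R) (hreg : IsSMulRegular M x) (n : ℕ)
    (h : Subsingleton (Ext (ModuleCat.of R (QuotSMulTop x M)) (ModuleCat.of R Y) (n + 1))) :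
    Subsingleton (Ext (ModuleCat.of R M) (ModuleCat.of R Y) n) := by
  have hfin : Module.Finite R (Ext (ModuleCat.of R M) (ModuleCat.of R Y) n) :=
    ModuleCat.finite_ext R (ModuleCat.of R M) (ModuleCat.of R Y) n
  by_contra hne
  rw [not_subsingleton_iff_nontrivial] at hne
  refine Submodule.top_ne_pointwise_smul_of_mem_jacobson_annihilator
    (M := Ext (ModuleCat.of R M) (ModuleCat.of R Y) n)
    (maximalIdeal_le_jacobson _ hx) (Eq.symm (eq_top_iff.2 fun a _ => ?_))
  obtain ⟨b, hb⟩ := Ext.contravariant_sequence_exact₁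
    (shortExact_shortComplexOfExact (exact_lsmul_quotSMulTop M x) hreg
      (Submodule.mkQ_surjective _)) (ModuleCat.of R Y) a (add_comm 1 n) (h.elim _ _)
  have h1 : Ext.mk₀ (ModuleCat.ofHom (LinearMap.lsmul R M x)) =
      x • Ext.mk₀ (𝟙 (ModuleCat.of R M)) := by
    rw [← Ext.mk₀_smul]; rfl
  rw [show Ext.mk₀ (shortComplexOfExact (exact_lsmul_quotSMulTop M x)).f =
      x • Ext.mk₀ (𝟙 (ModuleCat.of R M)) from h1, Ext.smul_comp, Ext.mk₀_id_comp] at hb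
  rw [← hb]
  exact Submodule.smul_mem_pointwise_smul b x ⊤ trivial

lemma subsingleton_ext_of_isWeaklyRegular {Y : Type u} [AddCommGroup Y] [Module R Y]
    [Module.Finite R Y] : ∀ (rs : List R) (M : Type u) [AddCommGroup M] [Module R M]
    [Module.Finite R M] (n : ℕ), (∀ r ∈ rs, r ∈ maximalIdeal R) → IsWeaklyRegular M rs →
    (∀ (N : Type u) [AddCommGroup N] [Module R N], Module.Finite R N →
      Subsingleton (Ext (ModuleCat.of R N) (ModuleCat.of R Y) (n + rs.length))) →
    Subsingleton (Ext (ModuleCat.of R M) (ModuleCat.of R Y) n)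
  | [], M, _, _, _, n, _, _, h => h M inferInstance
  | x :: rs, M, _, _, _, n, hm, hreg, h => by
    rw [isWeaklyRegular_cons_iff] at hreg
    refine subsingleton_ext_of_quotSMulTop (hm x List.mem_cons_self) hreg.1 n
      (subsingleton_ext_of_isWeaklyRegular rs _ (n + 1)
        (fun r hr => hm r (List.mem_cons_of_mem _ hr)) hreg.2 fun N _ _ hN => ?_)
    have := h N hN
    rwa [List.length_cons, ← add_assoc, add_right_comm] at this

/-- The residue field embeds into the quotient of a Cohen-Macaulay local ring of dimension `d` by
a regular sequence of length `d`. -/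
lemma exists_injective_residueField_of_isWeaklyRegular {d : ℕ}
    (hd : ringKrullDim R = (d : WithBot ℕ∞)) {rs : List R} (hm : ∀ r ∈ rs, r ∈ maximalIdeal R)
    (hrs : IsWeaklyRegular R rs) (hlen : rs.length = d) :
    ∃ f : ResidueField R →ₗ[R] (R ⧸ Ideal.ofList rs • (⊤ : Submodule R R)),
      Function.Injective f := by
  by_contra! hno
  have hsub : Subsingleton (ResidueField R →ₗ[R] (R ⧸ Ideal.ofList rs • (⊤ : Submodule R R))) := by
    refine subsingleton_of_forall_eq 0 fun f => ?_
    by_contra hf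
    refine hno f ((injective_iff_map_eq_zero f).2 fun a ha => ?_)
    by_contra ha0
    refine hf (LinearMap.ext fun b => ?_)
    obtain ⟨r, hr⟩ := residue_surjective (b / a)
    have hb : b = r • a := by
      rw [Algebra.smul_def]
      exact ((div_mul_cancel₀ b ha0).symm).trans (congrArg (· * a) hr.symm)
    rw [hb, map_smul, ha, smul_zero, LinearMap.zero_apply]
  obtain ⟨x, hx, hreg⟩ := exists_isSMulRegular_of_subsingleton_linearMap _ hsub
  have hrs' : IsWeaklyRegular R (rs ++ [x]) :=
    (isWeaklyRegular_append_iff R rs [x]).2 ⟨hrs, (isWeaklyRegular_singleton_iff _ x).2 hreg⟩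
  have hle := length_le_supportDim_of_isWeaklyRegular (M := R) (rs := rs ++ [x])
    (by simpa [or_imp, forall_and] using ⟨hm, hx⟩) hrs'
  rw [supportDim_self_eq_ringKrullDim, hd, List.length_append, hlen] at hle
  have : d + 1 ≤ d := by exact_mod_cast hle
  omega

/-- Over a Cohen-Macaulay local ring of dimension `d`, if `Extⁿ⁺¹(-, Y)` vanishes on finitely
generated modules and `n > d`, then so does `Extⁿ(-, Y)`. -/
lemma subsingleton_ext_of_succ {d : ℕ} (hd : ringKrullDim R = (d : WithBot ℕ∞))
    (hR : ExtResidueVanish R R d) {Y : Type u} [AddCommGroup Y] [Module R Y] [Module.Finite R Y]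
    {n : ℕ} (hn : d < n) (h : ∀ (N : Type u) [AddCommGroup N] [Module R N], Module.Finite R N →
      Subsingleton (Ext (ModuleCat.of R N) (ModuleCat.of R Y) (n + 1)))
    (N : Type u) [AddCommGroup N] [Module R N] (hN : Module.Finite R N) :
    Subsingleton (Ext (ModuleCat.of R N) (ModuleCat.of R Y) n) := by
  have hk : Subsingleton (Ext (ModuleCat.of R (ResidueField R)) (ModuleCat.of R Y) n) := by
    obtain ⟨rs, hm, hrs, hlen⟩ := hR.exists_isWeaklyRegular d R
    obtain ⟨f, hf⟩ := exists_injective_residueField_of_isWeaklyRegular hd hm hrs hlen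
    have hpd : projectiveDimension (ModuleCat.of R
        (R ⧸ Ideal.ofList rs • (⊤ : Submodule R R))) < n := by
      rw [ModuleCat.projectiveDimension_quotient_eq_add_length_of_isWeaklyRegular
        (ModuleCat.of R R) rs hrs hm, ModuleCat.projectiveDimension_eq_zero_of_projective, hlen,
        zero_add]
      exact_mod_cast hn
    have := (projectiveDimension_lt_iff (n := n)).1 hpd
    exact subsingleton_ext_kernel_left (LinearMap.exact_map_mkQ_range f) hf
      (Submodule.mkQ_surjective _) _ n
      (HasProjectiveDimensionLT.subsingleton _ n n le_rfl _) (h _ inferInstance)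
  induction hN using IsNoetherianRing.induction_on_isQuotientEquivQuotientPrime R with
  | subsingleton N =>
    have h0 : Limits.IsZero (ModuleCat.of R N) :=
      ModuleCat.isZero_of_subsingleton (M := ModuleCat.of R N)
    exact HasProjectiveDimensionLT.subsingleton
      (hX := h0.hasProjectiveDimensionLT_zero) _ 0 n (Nat.zero_le n) _
  | quotient N p e =>
    suffices Subsingleton (Ext (ModuleCat.of R (R ⧸ p.1)) (ModuleCat.of R Y) n) from
      subsingleton_ext_of_equiv_left _ e n
    by_cases hp : p.1 = maximalIdeal R
    · rw [hp]; exact hk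
    · obtain ⟨x, hx, hxp⟩ := SetLike.exists_of_lt
        (lt_of_le_of_ne (le_maximalIdeal p.2.ne_top) hp)
      have hreg : IsSMulRegular (R ⧸ p.1) x := by
        refine (isSMulRegular_quotient_iff_mem_of_smul_mem _ _).2 fun y hy => ?_
        exact (p.2.mem_or_mem hy).resolve_left hxp
      exact subsingleton_ext_of_quotSMulTop hx hreg n (h _ inferInstance)
  | exact N₁ N₂ N₃ f g hf hg hfg h₁ h₃ =>
    exact subsingleton_ext_middle_left hfg hf hg _ n h₁ h₃

/-- `Ext¹(M, ω) = 0` for a maximal Cohen-Macaulay module `M` and a canonical module `ω` of a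
Cohen-Macaulay local ring. -/
lemma subsingleton_ext_one_of_isMCM (hR : IsMCM R R) {Y : Type u} [AddCommGroup Y] [Module R Y]
    (hY : IsCanonicalModule R Y) {M : Type u} [AddCommGroup M] [Module R M] (hM : IsMCM R M) :
    Subsingleton (Ext (ModuleCat.of R M) (ModuleCat.of R Y) 1) := by
  obtain ⟨⟨hYfin, -⟩, ⟨m, hm⟩, d, hd, -⟩ := hY
  have hR' := ((isMCM_iff_extResidueVanish hd R).1 hR).2
  obtain ⟨hMfin, hM'⟩ := (isMCM_iff_extResidueVanish hd M).1 hM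
  have key (j : ℕ) : ∀ n, d < n → m + 1 ≤ n + j → ∀ (N : Type u) [AddCommGroup N] [Module R N],
      Module.Finite R N → Subsingleton (Ext (ModuleCat.of R N) (ModuleCat.of R Y) n) := by
    induction j with
    | zero => exact fun n _ hn N _ _ _ => HasInjectiveDimensionLT.subsingleton _ (m + 1) n hn _
    | succ j ih =>
      exact fun n hn hmn => subsingleton_ext_of_succ hd hR' hn (ih (n + 1) (by omega) (by omega))
  obtain ⟨rs, hrm, hrs, hlen⟩ := hM'.exists_isWeaklyRegular d M
  exact subsingleton_ext_of_isWeaklyRegular rs M 1 hrm hrs (key m _ (by omega) (by omega))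

end CanonicalVanishing
section MaximalCohenMacaulay

variable {R : Type u} [CommRing R] [IsLocalRing R] [IsNoetherianRing R] {d : ℕ}
  {A B C : Type u} [AddCommGroup A] [Module R A] [AddCommGroup B] [Module R B]
  [AddCommGroup C] [Module R C]

namespace IsMCM

lemma of_retract (hd : ringKrullDim R = (d : WithBot ℕ∞)) (hB : IsMCM R B) (s : A →ₗ[R] B)
    (p : B →ₗ[R] A) (hps : p ∘ₗ s = LinearMap.id) : IsMCM R A := by
  rw [isMCM_iff_extResidueVanish hd] at hB ⊢
  have := hB.1
  exact ⟨.of_surjective p fun x => ⟨s x, LinearMap.congr_fun hps x⟩, hB.2.of_retract s p hps⟩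

lemma of_equiv (hd : ringKrullDim R = (d : WithBot ℕ∞)) (hB : IsMCM R B) (e : A ≃ₗ[R] B) :
    IsMCM R A :=
  hB.of_retract hd e.toLinearMap e.symm.toLinearMap (by ext; simp)

lemma prod (hd : ringKrullDim R = (d : WithBot ℕ∞)) (hA : IsMCM R A) (hB : IsMCM R B) :
    IsMCM R (A × B) := by
  rw [isMCM_iff_extResidueVanish hd] at hA hB ⊢
  have := hA.1
  have := hB.1
  exact ⟨inferInstance, hA.2.prod hB.2⟩

lemma pi (hd : ringKrullDim R = (d : WithBot ℕ∞)) (hA : IsMCM R A) (n : ℕ) :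
    IsMCM R (Fin n → A) := by
  rw [isMCM_iff_extResidueVanish hd] at hA ⊢
  have := hA.1
  exact ⟨inferInstance, hA.2.pi n⟩

lemma kernel (hd : ringKrullDim R = (d : WithBot ℕ∞)) {f : A →ₗ[R] B} {g : B →ₗ[R] C}
    (h : Function.Exact f g) (hf : Function.Injective f) (hg : Function.Surjective g)
    (hB : IsMCM R B) (hC : IsMCM R C) : IsMCM R A := by
  rw [isMCM_iff_extResidueVanish hd] at hB hC ⊢
  have := hB.1
  exact ⟨.of_injective f hf,
    .kernel (Nat.le_succ d) h hf hg hB.2 hC.2⟩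

end IsMCM

end MaximalCohenMacaulay

section RightModules

variable {R : Type u} [CommRing R] {Λ : Type u} [Ring Λ] [Algebra R Λ]

/-- The homomorphism of right modules `a ↦ y a` from the regular module. -/
def regularLift {Y : Type u} [AddCommGroup Y] [Module Λᵐᵒᵖ Y] (y : Y) : Λ →ₗ[Λᵐᵒᵖ] Y where
  toFun a := op a • y
  map_add' a b := by rw [op_add, add_smul]
  map_smul' b a := by rw [← mul_smul]; rfl

lemma apply_eq_op_smul_apply_one {Y : Type u} [AddCommGroup Y] [Module Λᵐᵒᵖ Y]
    (f : Λ →ₗ[Λᵐᵒᵖ] Y) (a : Λ) : f a = op a • f 1 := by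
  rw [← map_smul]; exact congrArg f (one_mul a).symm

variable {X Y I : Type u} [AddCommGroup X] [Module Λᵐᵒᵖ X]
  [AddCommGroup Y] [Module R Y] [Module Λᵐᵒᵖ Y] [IsScalarTower R Λᵐᵒᵖ Y]
  [AddCommGroup I] [Module Λᵐᵒᵖ I]

/-- The right `Λ`-homomorphism to `Hom_R(Λ, N)` corresponding to an `R`-linear map to `N`. -/
def toOrderOmega [Module R X] [IsScalarTower R Λᵐᵒᵖ X] {N : Type u} [AddCommGroup N] [Module R N] (ψ : X →ₗ[R] N) :
    X →ₗ[Λᵐᵒᵖ] OrderOmega R Λ N where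
  toFun x := show Λ →ₗ[R] N from ψ ∘ₗ (regularLift (Λ := Λ) x).restrictScalars R
  map_add' x y := LinearMap.ext fun a =>
    (congrArg ψ (smul_add (op a) x y)).trans (map_add ψ _ _)
  map_smul' b x := LinearMap.ext fun a => congrArg ψ (mul_smul (op a) b x).symm

variable [IsLocalRing R] [IsNoetherianRing R] {d : ℕ}

lemma IsMCM.of_inAdd_regular [Module R X] [IsScalarTower R Λᵐᵒᵖ X]
    (hd : ringKrullDim R = (d : WithBot ℕ∞)) (hΛ : IsMCM R Λ)
    (hX : InAdd Λᵐᵒᵖ X Λ) : IsMCM R X := by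
  obtain ⟨n, s, p, hps⟩ := hX
  exact (hΛ.pi hd n).of_retract hd (s.restrictScalars R) (p.restrictScalars R)
    (LinearMap.ext fun x => LinearMap.congr_fun hps x)

lemma IsMCM.linearMap_of_inAdd_regular (hd : ringKrullDim R = (d : WithBot ℕ∞))
    (hX : InAdd Λᵐᵒᵖ X Λ) (hY : IsMCM R Y) : IsMCM R (X →ₗ[Λᵐᵒᵖ] Y) := by
  obtain ⟨n, s, p, hps⟩ := hX
  let σ : (X →ₗ[Λᵐᵒᵖ] Y) →ₗ[R] (Fin n → Y) :=
    { toFun := fun φ i => φ (p (Pi.single i 1))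
      map_add' := fun _ _ => rfl
      map_smul' := fun _ _ => rfl }
  let π : (Fin n → Y) →ₗ[R] (X →ₗ[Λᵐᵒᵖ] Y) :=
    { toFun := fun v => ∑ i, regularLift (v i) ∘ₗ LinearMap.proj i ∘ₗ s
      map_add' := fun v w => by
        rw [← Finset.sum_add_distrib]
        refine Finset.sum_congr rfl fun i _ => LinearMap.ext fun x => smul_add _ _ _
      map_smul' := fun r v => by
        rw [Finset.smul_sum]
        refine Finset.sum_congr rfl fun i _ => LinearMap.ext fun x => ?_
        exact smul_comm (op (s x i)) r (v i) }
  refine (hY.pi hd n).of_retract hd σ π (LinearMap.ext fun φ => LinearMap.ext fun x => ?_)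
  have hx : s x = ∑ i, op (s x i) • (Pi.single i 1 : Fin n → Λ) := by
    ext j
    rw [Finset.sum_apply, Finset.sum_eq_single j]
    · simp
    · intro i _ hij; simp [Pi.single_eq_of_ne hij.symm]
    · simp
  have h1 : (π (σ φ)) x = ∑ i, op (s x i) • φ (p (Pi.single i 1)) := by
    change (∑ i, regularLift (σ φ i) ∘ₗ LinearMap.proj i ∘ₗ s) x = _
    rw [LinearMap.sum_apply]; rfl
  have h2 : p (s x) = x := LinearMap.congr_fun hps x
  change π (σ φ) x = φ x
  conv_rhs => rw [← h2, hx, map_sum, map_sum]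
  rw [h1]
  simp only [map_smul]

/-- If evaluation at the image of `1` maps `Hom_Λ(I, Y)` onto `Y`, then its kernel
`Hom_Λ(I / Λ, Y)` is maximal Cohen-Macaulay. -/
lemma IsMCM.linearMap_cokernel_regular (hd : ringKrullDim R = (d : WithBot ℕ∞))
    (f : Λ →ₗ[Λᵐᵒᵖ] I) (hY : IsMCM R Y) (hI : IsMCM R (I →ₗ[Λᵐᵒᵖ] Y))
    (hsurj : ∀ y : Y, ∃ h : I →ₗ[Λᵐᵒᵖ] Y, h (f 1) = y) :
    IsMCM R ((I ⧸ LinearMap.range f) →ₗ[Λᵐᵒᵖ] Y) := by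
  let α : ((I ⧸ LinearMap.range f) →ₗ[Λᵐᵒᵖ] Y) →ₗ[R] (I →ₗ[Λᵐᵒᵖ] Y) :=
    { toFun := fun φ => φ ∘ₗ (LinearMap.range f).mkQ
      map_add' := fun _ _ => rfl
      map_smul' := fun _ _ => rfl }
  let β : (I →ₗ[Λᵐᵒᵖ] Y) →ₗ[R] Y :=
    { toFun := fun φ => φ (f 1)
      map_add' := fun _ _ => rfl
      map_smul' := fun _ _ => rfl }
  refine IsMCM.kernel hd (f := α) (g := β) (fun φ => ⟨fun h => ?_, ?_⟩) ?_ hsurj hI hY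
  · refine ⟨(LinearMap.range f).liftQ φ ?_, LinearMap.ext fun x => rfl⟩
    rintro _ ⟨a, rfl⟩
    have h : φ (f 1) = 0 := h
    rw [LinearMap.mem_ker, apply_eq_op_smul_apply_one f, map_smul, h, smul_zero]
  · rintro ⟨ψ, rfl⟩
    have h0 : (LinearMap.range f).mkQ (f 1) = 0 :=
      (Submodule.Quotient.mk_eq_zero _).2 (LinearMap.mem_range_self f 1)
    exact (congrArg ψ h0).trans (map_zero ψ)
  · intro φ ψ h
    exact LinearMap.ext fun x => by
      obtain ⟨x, rfl⟩ := Submodule.mkQ_surjective _ x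
      exact LinearMap.congr_fun (show φ ∘ₗ (LinearMap.range f).mkQ = ψ ∘ₗ _ from h) x

namespace CMInjCoresolution

variable (C : CMInjCoresolution R Λ)

lemma extResidueVanish_ker (hd : ringKrullDim R = (d : WithBot ℕ∞)) : ∀ n ≤ d, ∀ j,
    ExtResidueVanish R (LinearMap.ker ((C.d j).restrictScalars R)) n
  | 0, _, _ => fun i hi => absurd hi (Nat.not_lt_zero i)
  | n + 1, hn, j => by
    have hI := ((isMCM_iff_extResidueVanish hd _).1 (C.cmInjective j).1).2.mono hn
    have hmem (x : C.I j) : (C.d j).restrictScalars R x ∈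
        LinearMap.ker ((C.d (j + 1)).restrictScalars R) := (C.exact_succ j _).2 ⟨x, rfl⟩
    refine ExtResidueVanish.kernel le_rfl
      (f := (LinearMap.ker ((C.d j).restrictScalars R)).subtype)
      (g := ((C.d j).restrictScalars R).codRestrict _ hmem) ?_ (Submodule.subtype_injective _) ?_
      hI (extResidueVanish_ker hd n (by omega) (j + 1))
    · intro x
      rw [Submodule.coe_subtype, Subtype.range_coe]
      exact Subtype.ext_iff
    · rintro ⟨y, hy⟩
      obtain ⟨x, rfl⟩ := (C.exact_succ j y).1 hy
      exact ⟨x, rfl⟩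

/-- The cokernel of `Λ → I⁰` is the module of `1`-cocycles. -/
noncomputable def kEquivKer : C.K ≃ₗ[R] LinearMap.ker ((C.d 1).restrictScalars R) :=
  have h0 : LinearMap.range C.ι ≤ LinearMap.ker (C.d 0) := by
    rintro _ ⟨a, rfl⟩
    exact (C.exact_zero _).2 ⟨a, rfl⟩
  let φ : C.K →ₗ[R] C.I 1 := ((LinearMap.range C.ι).liftQ (C.d 0) h0).restrictScalars R
  have hφ : ∀ x, φ x ∈ LinearMap.ker ((C.d 1).restrictScalars R) := fun x => by
    obtain ⟨y, rfl⟩ := Submodule.mkQ_surjective _ x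
    exact (C.exact_succ 0 _).2 ⟨y, rfl⟩
  LinearEquiv.ofBijective (φ.codRestrict _ hφ) (by
    constructor
    · refine (injective_iff_map_eq_zero _).2 fun x hx => ?_
      obtain ⟨y, rfl⟩ := Submodule.mkQ_surjective _ x
      have hy : C.d 0 y = 0 := congrArg Subtype.val hx
      exact (Submodule.Quotient.mk_eq_zero _).2 ((C.exact_zero y).1 hy)
    · rintro ⟨y, hy⟩
      obtain ⟨x, rfl⟩ := (C.exact_succ 0 y).1 hy
      exact ⟨Submodule.Quotient.mk x, rfl⟩)

/-- The projection `I⁰ → K` as an `R`-linear map. -/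
def projK : C.I 0 →ₗ[R] C.K := (LinearMap.range C.ι).mkQ.restrictScalars R

omit [IsNoetherianRing R] in
lemma projK_surjective : Function.Surjective C.projK := fun x =>
  Submodule.mkQ_surjective (LinearMap.range C.ι) x

omit [IsNoetherianRing R] in
lemma exact_ι_projK : Function.Exact (C.ι.restrictScalars R) C.projK := fun x =>
  LinearMap.exact_map_mkQ_range C.ι x

lemma isMCM_K (hd : ringKrullDim R = (d : WithBot ℕ∞)) : IsMCM R C.K := by
  have := ((isMCM_iff_extResidueVanish hd _).1 (C.cmInjective 0).1).1
  rw [isMCM_iff_extResidueVanish hd]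
  exact ⟨.of_surjective C.projK C.projK_surjective,
    (C.extResidueVanish_ker hd d le_rfl 1).of_equiv C.kEquivKer⟩

omit [IsNoetherianRing R] in
/-- Every homomorphism `Λ → K` factors through `Λ → I⁰`. -/
lemma exists_linearMap_K_apply_eq (hΛ : IsMCM R Λ) (hK : IsMCM R C.K) (x : C.K) :
    ∃ h : C.I 0 →ₗ[Λᵐᵒᵖ] C.K, h (C.ι 1) = x := by
  obtain ⟨y, rfl⟩ := Submodule.mkQ_surjective _ x
  obtain ⟨h, hh⟩ := (C.cmInjective 0).2 Λ (C.I 0) C.ι hΛ (C.cmInjective 0).1 C.ι_injective hK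
    (regularLift y)
  refine ⟨(LinearMap.range C.ι).mkQ ∘ₗ h, ?_⟩
  have h1 : h (C.ι 1) = y := (LinearMap.congr_fun hh 1).trans (one_smul _ y)
  rw [LinearMap.comp_apply, h1]

/-- Every homomorphism from `Λ` to a module in `add ω` factors through `Λ → I⁰`. -/
lemma exists_linearMap_apply_eq_of_inAdd_orderOmega (hR : IsMCM R R) {ωR : Type u}
    [AddCommGroup ωR] [Module R ωR] (hω : IsCanonicalModule R ωR) (hK : IsMCM R C.K)
    (hX : InAdd Λᵐᵒᵖ X (OrderOmega R Λ ωR)) (x : X) :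
    ∃ h : C.I 0 →ₗ[Λᵐᵒᵖ] X, h (C.ι 1) = x := by
  obtain ⟨n, s, p, hps⟩ := hX
  have hext (φ : Λ →ₗ[R] ωR) : ∃ ψ : C.I 0 →ₗ[R] ωR, ψ ∘ₗ C.ι.restrictScalars R = φ :=
    exists_extension_of_subsingleton_ext_one C.exact_ι_projK C.ι_injective C.projK_surjective (subsingleton_ext_one_of_isMCM hR hω hK) φ
  choose ψ hψ using fun i => hext (s x i)
  refine ⟨p ∘ₗ LinearMap.pi fun i => toOrderOmega (ψ i), ?_⟩
  have h1 : (LinearMap.pi fun i => toOrderOmega (Λ := Λ) (ψ i)) (C.ι 1) = s x := by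
    funext i
    refine LinearMap.ext fun a => ?_
    refine Eq.trans ?_ (LinearMap.congr_fun (hψ i) a)
    exact congrArg (ψ i) (apply_eq_op_smul_apply_one C.ι a).symm
  rw [LinearMap.comp_apply, h1]
  exact LinearMap.congr_fun hps x

end CMInjCoresolution

end RightModules

theorem mainTheorem3
    (R : Type u) [CommRing R] [IsLocalRing R] [IsNoetherianRing R] (hR : IsMCM R R)
    (ωR : Type u) [AddCommGroup ωR] [Module R ωR] (hω : IsCanonicalModule R ωR)
    (Λ : Type u) [Ring Λ] [Algebra R Λ] (hΛ : IsOrder R Λ) (hsp : IsSemiperfect Λ)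
    (P : Type u) [AddCommGroup P] [Module R P] [Module Λᵐᵒᵖ P] [IsScalarTower R Λᵐᵒᵖ P]
    (hP : IsCMProjInjGenerator R Λ ωR P) (hQF3 : IsQF3 R Λ)
    (C : CMInjCoresolution R Λ) (hC : InAdd Λᵐᵒᵖ (C.I 0) P) :
    IsMCM R C.K ∧ IsOrder R (Module.End Λᵐᵒᵖ (C.K × P)) := by
  obtain ⟨d, hd, -⟩ := hω.2.2
  have hK : IsMCM R C.K := C.isMCM_K hd
  refine ⟨hK, ?_⟩
  obtain ⟨hPΛ, hPω⟩ := (hP P).1 ⟨1, LinearMap.pi fun _ => LinearMap.id, LinearMap.proj 0, rfl⟩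
  have hT : IsMCM R (C.K × P) := hK.prod hd (IsMCM.of_inAdd_regular hd hΛ hPΛ)
  have hKT : IsMCM R (C.K →ₗ[Λᵐᵒᵖ] C.K × P) := by
    refine IsMCM.linearMap_cokernel_regular hd C.ι hT
      (IsMCM.linearMap_of_inAdd_regular hd ((hP (C.I 0)).1 hC).1 hT) fun y => ?_
    obtain ⟨h₁, h₁'⟩ := C.exists_linearMap_K_apply_eq hΛ hK y.1
    obtain ⟨h₂, h₂'⟩ := C.exists_linearMap_apply_eq_of_inAdd_orderOmega hR hω hK hPω y.2
    exact ⟨h₁.prod h₂, Prod.ext h₁' h₂'⟩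
  exact (hKT.prod hd (IsMCM.linearMap_of_inAdd_regular hd hPΛ hT)).of_equiv hd
    (LinearMap.coprodEquiv R).symm
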